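/- Let $\mathbb{C}_0=\{s\in\mathbb{C}:\operatorname{Re}s>0\}$ and let $\mathcal{A}^+$ be the algebra of all functions $f:\mathbb{C}_0\to\mathbb{C}$ of the form $f(s)=\sum_{n=1}^\infty a_n n^{-s}$ with $\sum_{n=1}^\infty|a_n|<\infty$. Let $\varphi:\mathbb{C}_0\to\mathbb{C}_0$ induce a composition operator $C_\varphi:\mathcal{A}^+\to\mathcal{A}^+$, i.e. $f\circ\varphi\in\mathcal{A}^+$ for every $f\in\mathcal{A}^+$. Suppose moreover that $\varphi$ extends to a continuous function $\overline{\mathbb{C}_0}=\{s\in\mathbb{C}:\operatorname{Re}s\ge 0\}\to\mathbb{C}$, still denoted by $\varphi$, with $\varphi(i\mathbb{R})\subseteq i\mathbb{R}$. Then there are $c_0\in\mathbb{N}_0=\{0,1,2,\dots\}$ and $\tau\in\mathbb{R}$ such that $\varphi(s)=c_0s+i\tau$ for all $s\in\mathbb{C}_0$. -/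

import Mathlib

/-- The open right half-plane `ℂ₀ = {s : ℂ | 0 < Re s}`, as a type. -/
abbrev RightHalfPlane : Type := {s : ℂ // 0 < s.re}

/-- The Wiener-Dirichlet algebra `𝒜⁺`, as a set of functions on `ℂ₀`: the sums
`f s = ∑_{n ≥ 1} a n * n ^ (-s)` of the Dirichlet series with `∑ |a n| < ∞`.
(`LSeriesHasSum a s w` says that `∑_{n ≥ 1} a n / n ^ s` converges absolutely to `w`; the term
of index `0` is `0`.) -/
def wienerDirichlet : Set (RightHalfPlane → ℂ) :=
  {f | ∃ a : ℕ → ℂ, Summable (fun n => ‖a n‖) ∧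
    ∀ s : RightHalfPlane, LSeriesHasSum a (s : ℂ) (f s)}

/-- `φ : ℂ₀ → ℂ₀` induces a composition operator `C_φ : 𝒜⁺ → 𝒜⁺`, `C_φ f = f ∘ φ`. -/
def InducesCompositionOperator (φ : RightHalfPlane → RightHalfPlane) : Prop :=
  ∀ f ∈ wienerDirichlet, f ∘ φ ∈ wienerDirichlet

open Complex Set Filter Topology

/-! Each `n ^ (-φ)` is a Dirichlet series, so `φ` is a continuous logarithm of a holomorphic
function up to a factor, hence holomorphic. As `φ` maps the imaginary axis to itself, Schwarz
reflection extends it to an entire function. The Schwarz lemma bounds its norm by `C (‖s‖ + 1) ^ 2 /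
|Re s|`, which forces it to be affine: `φ s = c s + iτ` (`eq_affine_of_mapsTo_re_pos`). The leading
term of the series of `n ^ (-φ)` then shows that `n ^ c` is an integer for every `n ≥ 1`. High
differences of `x ^ c` at integers are then integers tending to `0`, yet nonzero unless `c ∈ ℕ`. -/

/-! ### Integrality of the powers `n ^ c`. -/

/-- **Mean value theorem for iterated forward differences.** -/
theorem exists_fwdDiff_iter_eq (k : ℕ) :
    ∀ (h : ℕ → ℝ → ℝ), (∀ i, ∀ x > 0, HasDerivAt (h i) (h (i + 1) x) x) →
      ∀ x > 0, ∃ ξ ≥ x, (fwdDiff (1 : ℝ))^[k] (h 0) x = h k ξ := by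
  induction k with
  | zero => exact fun h _ x _ => ⟨x, le_rfl, rfl⟩
  | succ k ih =>
    intro h hh x hx
    obtain ⟨ξ, hξ, e⟩ := ih (fun i => fwdDiff (1 : ℝ) (h i)) (fun i y hy => by
      have h1 : HasDerivAt (fun y => h i (y + 1)) (h (i + 1) (y + 1)) y :=
        (hh i (y + 1) (by linarith)).comp_add_const y 1
      exact h1.sub (hh i y hy)) x hx
    obtain ⟨η, hη, e'⟩ := exists_hasDerivAt_eq_slope (h k) (h (k + 1)) (lt_add_one ξ)
      (fun y hy => (hh k y (by linarith [hy.1])).continuousAt.continuousWithinAt)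
      (fun y hy => hh k y (by linarith [hy.1]))
    refine ⟨η, by linarith [hη.1], ?_⟩
    rw [Function.iterate_succ_apply, e, e']
    simp [fwdDiff]

theorem fwdDiff_iter_int_valued {f : ℝ → ℝ} (hf : ∀ n : ℕ, 1 ≤ n → ∃ m : ℤ, f n = m) (k : ℕ) :
    ∀ n : ℕ, 1 ≤ n → ∃ m : ℤ, (fwdDiff (1 : ℝ))^[k] f n = m := by
  induction k with
  | zero => exact hf
  | succ k ih =>
    intro n hn
    obtain ⟨a, ha⟩ := ih n hn
    obtain ⟨b, hb⟩ := ih (n + 1) (by omega)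
    refine ⟨b - a, ?_⟩
    rw [Function.iterate_succ_apply', fwdDiff, ha]
    push_cast at hb ⊢
    rw [hb]

/-- If `n ^ c` is an integer for every positive integer `n`, then `c` is a natural number. -/
theorem exists_nat_eq_of_forall_rpow_int {c : ℝ}
    (h : ∀ n : ℕ, 1 ≤ n → ∃ m : ℤ, (n : ℝ) ^ c = m) : ∃ k : ℕ, c = k := by
  by_contra! hne
  -- With `k > c`, the `k`-th derivative `P k * x ^ (c - k)` of `x ^ c` tends to `0` without
  -- vanishing.
  set k := ⌊c⌋₊ + 1 with hk
  have hck : c < k := by rw [hk]; push_cast; exact Nat.lt_floor_add_one c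
  let P : ℕ → ℝ := fun i => ∏ j ∈ Finset.range i, (c - j)
  have hP : P k ≠ 0 := Finset.prod_ne_zero_iff.2 fun j _ => sub_ne_zero.2 (hne j)
  have hd : ∀ i, ∀ x > (0 : ℝ), HasDerivAt (fun x : ℝ => P i * x ^ (c - i))
      (P (i + 1) * x ^ (c - (i + 1 : ℕ))) x := by
    intro i x hx
    have := (Real.hasDerivAt_rpow_const (p := c - i) (Or.inl hx.ne')).const_mul (P i)
    refine this.congr_deriv ?_
    simp only [P, Finset.prod_range_succ]
    push_cast
    rw [← sub_sub, mul_assoc]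
  have hlim : Tendsto (fun x : ℝ => |P k| * x ^ (-(k - c))) atTop (𝓝 (|P k| * 0)) :=
    (tendsto_rpow_neg_atTop (by linarith)).const_mul _
  rw [mul_zero] at hlim
  obtain ⟨N, hN⟩ := eventually_atTop.1 (hlim.eventually (gt_mem_nhds one_pos))
  obtain ⟨n, hn⟩ := exists_nat_ge (max N 1)
  have hn1 : (1 : ℝ) ≤ n := (le_max_right _ _).trans hn
  have hnN : N ≤ n := (le_max_left _ _).trans hn
  obtain ⟨ξ, hξ, e⟩ := exists_fwdDiff_iter_eq k (fun i x => P i * x ^ (c - i)) hd n (by linarith)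
  have hf0 : (fun x : ℝ => P 0 * x ^ (c - (0 : ℕ))) = fun x => x ^ c := by
    funext x; simp [P]
  obtain ⟨m, hm⟩ := fwdDiff_iter_int_valued (f := fun x : ℝ => x ^ c) h k n (by exact_mod_cast hn1)
  simp only [hf0, hm] at e
  have hξ0 : 0 < ξ := by linarith
  have hpos : 0 < ξ ^ (c - k) := Real.rpow_pos_of_pos hξ0 _
  have hm1 : |(m : ℝ)| < 1 := by
    rw [e, abs_mul, abs_of_pos hpos, show c - (k : ℝ) = -(k - c) by ring]
    exact hN ξ (hnN.trans hξ)
  have hm0 : m = 0 := by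
    rw [← Int.cast_abs] at hm1
    exact Int.abs_lt_one_iff.1 (by exact_mod_cast hm1)
  rw [hm0, Int.cast_zero] at e
  exact (mul_ne_zero hP hpos.ne') e.symm

/-! ### Complex analysis: removability, growth, logarithms. -/

/-- A continuous function that is holomorphic off the imaginary axis is entire. -/
theorem differentiable_of_continuous_of_re_ne_zero {f : ℂ → ℂ} (hf : Continuous f)
    (hd : ∀ z : ℂ, z.re ≠ 0 → DifferentiableAt ℂ f z) : Differentiable ℂ f := by
  rw [← differentiableOn_univ, ← isConservativeOn_and_continuousOn_iff_isDifferentiableOn isOpen_univ]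
  refine ⟨fun z w _ => ?_, hf.continuousOn⟩
  rw [← add_eq_zero_iff_eq_neg, wedgeIntegral_add_wedgeIntegral_eq]
  -- A rectangle with a side on the axis has its interior off the axis, so Cauchy's theorem applies;
  -- a general rectangle is cut along the axis.
  have key : ∀ u v : ℂ, (u.re = 0 ∨ v.re = 0) →
      (∫ x : ℝ in u.re..v.re, f (x + u.im * I)) - (∫ x : ℝ in u.re..v.re, f (x + v.im * I)) +
      I • (∫ y : ℝ in u.im..v.im, f (v.re + y * I)) -
      I • (∫ y : ℝ in u.im..v.im, f (u.re + y * I)) = 0 := by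
    intro u v huv
    refine integral_boundary_rect_eq_zero_of_continuousOn_of_differentiableOn f u v
      hf.continuousOn fun s hs => (hd s fun h0 => ?_).differentiableWithinAt
    have hs1 := hs.1
    simp only [mem_preimage, h0, mem_Ioo] at hs1
    rcases huv with h | h
    · rw [h] at hs1
      rcases le_total 0 v.re with h' | h' <;> simp [h'] at hs1
    · rw [h] at hs1
      rcases le_total 0 u.re with h' | h' <;> simp [h'] at hs1
  have h1 := key z ⟨0, w.im⟩ (Or.inr rfl)
  have h2 := key ⟨0, z.im⟩ w (Or.inl rfl)
  have hi : ∀ (c a b : ℝ),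
      IntervalIntegrable (fun x : ℝ => f (x + c * I)) MeasureTheory.volume a b :=
    fun c a b => (by fun_prop : Continuous fun x : ℝ => f (x + c * I)).intervalIntegrable a b
  rw [← intervalIntegral.integral_add_adjacent_intervals (hi z.im z.re 0) (hi z.im 0 w.re),
    ← intervalIntegral.integral_add_adjacent_intervals (hi w.im z.re 0) (hi w.im 0 w.re)]
  simp only at h1 h2
  linear_combination h1 + h2

/-- Points of the half-plane are closer to `p` than to its mirror image `-conj p`; thus `(w - p) /
(w + conj p)` lies in the unit disc. -/
theorem norm_sub_lt_norm_add_conj {w p : ℂ} (hw : 0 < w.re) (hp : 0 < p.re) :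
    ‖w - p‖ < ‖w + (starRingEnd ℂ) p‖ := by
  refine lt_of_pow_lt_pow_left₀ 2 (norm_nonneg _) ?_
  rw [← normSq_eq_norm_sq, ← normSq_eq_norm_sq, normSq_apply, normSq_apply]
  simp only [sub_re, sub_im, add_re, add_im, conj_re, conj_im]
  nlinarith [mul_pos hw hp]

/-- Growth of a holomorphic self-map of the right half-plane, from the Schwarz lemma. -/
theorem norm_mul_re_le_of_mapsTo_re_pos {f : ℂ → ℂ} (hd : DifferentiableOn ℂ f {s | 0 < s.re})
    (hf : ∀ s : ℂ, 0 < s.re → 0 < (f s).re) {s : ℂ} (hs : 0 < s.re) :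
    ‖f s‖ * s.re ≤ ‖f 1‖ * ‖s + 1‖ ^ 2 := by
  set p := f 1 with hp
  have hp0 : 0 < p.re := hf 1 (by simp)
  -- Cayley maps on both sides turn `f` into a self-map `h` of the disc fixing `0`.
  let q : ℂ → ℂ := fun z => (1 + z) / (1 - z)
  let h : ℂ → ℂ := fun z => (f (q z) - p) / (f (q z) + (starRingEnd ℂ) p)
  have hz1 : ∀ z ∈ Metric.ball (0 : ℂ) 1, 1 - z ≠ 0 := by
    intro z hz h0
    rw [← sub_eq_zero.1 h0] at hz
    simp at hz
  have hq : ∀ z ∈ Metric.ball (0 : ℂ) 1, 0 < (q z).re := by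
    intro z hz
    have hn : 0 < normSq (1 - z) := normSq_pos.2 (hz1 z hz)
    have hlt : normSq z < 1 := by
      rw [normSq_eq_norm_sq]
      have := mem_ball_zero_iff.1 hz
      nlinarith [norm_nonneg z]
    have : (q z).re = (1 - normSq z) / normSq (1 - z) := by
      simp only [q, div_re, normSq_apply, add_re, add_im, sub_re, sub_im, one_re, one_im]
      ring
    rw [this]
    exact div_pos (by linarith) hn
  have hden : ∀ {w : ℂ}, 0 < w.re → w + (starRingEnd ℂ) p ≠ 0 := fun hw =>
    norm_pos_iff.1 ((norm_nonneg _).trans_lt (norm_sub_lt_norm_add_conj hw hp0))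
  have hqd : DifferentiableOn ℂ q (Metric.ball 0 1) := by
    intro z hz
    exact (((differentiableAt_const 1).add differentiableAt_id).div
      ((differentiableAt_const 1).sub differentiableAt_id) (hz1 z hz)).differentiableWithinAt
  have hfq : DifferentiableOn ℂ (fun z => f (q z)) (Metric.ball 0 1) := hd.comp hqd hq
  have hh : DifferentiableOn ℂ h (Metric.ball 0 1) :=
    (hfq.sub_const p).div (hfq.add_const _) fun z hz => hden (hf _ (hq z hz))
  have hm : MapsTo h (Metric.ball 0 1) (Metric.closedBall 0 1) := by
    intro z hz
    rw [mem_closedBall_zero_iff, norm_div]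
    exact div_le_one_of_le₀ (norm_sub_lt_norm_add_conj (hf _ (hq z hz)) hp0).le (norm_nonneg _)
  have h0 : h 0 = 0 := by simp [h, q, hp]
  have hs1 : s + 1 ≠ 0 := by
    intro h
    have := congrArg re h
    simp at this
    linarith
  have hs1' : 0 < ‖s + 1‖ := norm_pos_iff.2 hs1
  have hlt : ‖s - 1‖ < ‖s + 1‖ := by
    simpa using norm_sub_lt_norm_add_conj (p := 1) hs (by simp)
  set z := (s - 1) / (s + 1) with hz
  have hzn : ‖z‖ = ‖s - 1‖ / ‖s + 1‖ := norm_div _ _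
  have hzl : ‖z‖ < 1 := by rw [hzn]; exact (div_lt_one hs1').2 hlt
  have hqz : q z = s := by
    have h3 : 1 - z ≠ 0 := hz1 z (mem_ball_zero_iff.2 hzl)
    have h4 : 1 - z = 2 / (s + 1) := by rw [hz]; field_simp; ring
    have h5 : 1 + z = 2 * s / (s + 1) := by rw [hz]; field_simp; ring
    simp only [q]
    rw [h4, h5]
    field_simp
  have hle : ‖h z‖ ≤ ‖z‖ := norm_le_norm_of_mapsTo_ball hh hm h0 hzl
  have hhz : h z * (f s + (starRingEnd ℂ) p) = f s - p := by
    simp only [h, hqz]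
    exact div_mul_cancel₀ _ (hden (hf s hs))
  have h6 : ‖f s - p‖ ≤ ‖z‖ * (‖f s‖ + ‖p‖) := by
    rw [← hhz, norm_mul]
    refine mul_le_mul hle ((norm_add_le _ _).trans_eq ?_) (norm_nonneg _) (norm_nonneg _)
    rw [RCLike.norm_conj]
  have h7 : ‖f s‖ - ‖p‖ ≤ ‖f s - p‖ := norm_sub_norm_le _ _
  have h8 : ‖f s‖ * (1 - ‖z‖) ≤ 2 * ‖p‖ := by nlinarith [norm_nonneg p]
  have h9 : ‖f s‖ * (‖s + 1‖ - ‖s - 1‖) ≤ 2 * ‖p‖ * ‖s + 1‖ := by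
    have : ‖s - 1‖ = ‖z‖ * ‖s + 1‖ := by rw [hzn]; field_simp
    rw [this]
    nlinarith
  have h10 : (‖s + 1‖ - ‖s - 1‖) * (‖s + 1‖ + ‖s - 1‖) = 4 * s.re := by
    have e1 := normSq_eq_norm_sq (s + 1)
    have e2 := normSq_eq_norm_sq (s - 1)
    rw [normSq_apply] at e1 e2
    simp only [add_re, add_im, sub_re, sub_im, one_re, one_im] at e1 e2
    nlinarith
  have h11 : ‖f s‖ * (4 * s.re) ≤ 2 * ‖p‖ * ‖s + 1‖ * (2 * ‖s + 1‖) := by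
    rw [← h10, ← mul_assoc]
    refine mul_le_mul h9 (by linarith) (by positivity) (by positivity)
  nlinarith

/-- An entire function with `‖F s‖ |Re s| = O((‖s‖ + 1) ^ 2)` is affine. -/
theorem eq_affine_of_norm_mul_abs_re_le {F : ℂ → ℂ} (hF : Differentiable ℂ F) {C : ℝ}
    (hC : ∀ s, ‖F s‖ * |s.re| ≤ C * (‖s‖ + 1) ^ 2) : ∃ a b : ℂ, ∀ s, F s = a * s + b := by
  have hC0 : 0 ≤ C := by simpa using hC 0
  have hball : ∀ R : ℝ, 1 ≤ R → ∀ s : ℂ, ‖s‖ ≤ R / 2 → ‖F s‖ ≤ 11 * C * R := by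
    intro R hR s hs
    have hR0 : 0 < R := by linarith
    -- On `‖w‖ = R`, `w ^ 2 + R ^ 2 = 2 w Re w`, which absorbs the blow-up at the axis; the maximum
    -- principle carries the bound inside.
    have hG : ‖F s * (s ^ 2 + R ^ 2)‖ ≤ 8 * C * R ^ 3 := by
      refine norm_le_of_forall_mem_frontier_norm_le (U := Metric.ball 0 R) Metric.isBounded_ball
        (f := fun s => F s * (s ^ 2 + R ^ 2))
        (hF.mul ((differentiable_id.pow 2).add_const _)).diffContOnCl ?_
        (subset_closure (mem_ball_zero_iff.2 (by linarith)))
      intro w hw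
      rw [frontier_ball _ hR0.ne', mem_sphere_zero_iff_norm] at hw
      have e : w ^ 2 + (R : ℂ) ^ 2 = w * (2 * w.re : ℝ) := by
        have : (R : ℂ) ^ 2 = w * (starRingEnd ℂ) w := by
          rw [mul_conj, normSq_eq_norm_sq, hw]; push_cast; ring
        rw [this, sq, ← mul_add, add_conj]
      rw [norm_mul, e, norm_mul, hw, norm_real, Real.norm_eq_abs, abs_mul, abs_two]
      have h1 := hC w
      rw [hw] at h1
      have h2 : C * (R + 1) ^ 2 ≤ C * (2 * R) ^ 2 := by gcongr; linarith
      calc ‖F w‖ * (R * (2 * |w.re|)) = 2 * R * (‖F w‖ * |w.re|) := by ring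
        _ ≤ 2 * R * (C * (2 * R) ^ 2) :=
          mul_le_mul_of_nonneg_left (h1.trans h2) (by positivity)
        _ = 8 * C * R ^ 3 := by ring
    have hlow : 3 / 4 * R ^ 2 ≤ ‖s ^ 2 + (R : ℂ) ^ 2‖ := by
      have h1 : ‖(R : ℂ) ^ 2‖ - ‖s ^ 2‖ ≤ ‖(R : ℂ) ^ 2 + s ^ 2‖ := norm_sub_le_norm_add _ _
      rw [norm_pow, norm_pow, norm_real, Real.norm_eq_abs, sq_abs, add_comm] at h1
      nlinarith [norm_nonneg s]
    rw [norm_mul] at hG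
    have h3 : ‖F s‖ * (3 / 4 * R ^ 2) ≤ 8 * C * R ^ 3 :=
      (mul_le_mul_of_nonneg_left hlow (norm_nonneg _)).trans hG
    have h4 : ‖F s‖ * (3 / 4) ≤ 8 * C * R := by
      refine le_of_mul_le_mul_right ?_ (pow_pos hR0 2)
      linarith
    nlinarith [mul_nonneg hC0 hR0.le]
  have h2 : ∀ c, deriv (deriv F) c = 0 := by
    intro c
    -- Cauchy's estimate on radius `R / 4`, inside the disc of `hball`: `352 = 2! * 11 * 4 ^ 2`.
    have hb : ∀ R : ℝ, max 1 (4 * ‖c‖) ≤ R → ‖iteratedDeriv 2 F c‖ ≤ 352 * C / R := by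
      intro R hR
      have hR1 : 1 ≤ R := (le_max_left _ _).trans hR
      have hRc : 4 * ‖c‖ ≤ R := (le_max_right _ _).trans hR
      have := norm_iteratedDeriv_le_of_forall_mem_sphere_norm_le (f := F) (c := c) (R := R / 4)
        (C := 11 * C * R) 2 (by linarith) hF.diffContOnCl (fun z hz => hball R hR1 z (by
          rw [mem_sphere_iff_norm] at hz
          have := norm_le_norm_sub_add z c
          linarith))
      refine this.trans_eq ?_
      simp only [Nat.factorial]
      field_simp
      ring
    have hlim : Tendsto (fun R : ℝ => 352 * C / R) atTop (𝓝 0) :=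
      tendsto_const_nhds.div_atTop tendsto_id
    have := ge_of_tendsto hlim (eventually_atTop.2 ⟨_, hb⟩)
    rw [← norm_le_zero_iff]
    simpa [iteratedDeriv_succ, iteratedDeriv_zero] using this
  have hd' : Differentiable ℂ (deriv F) := by
    have := hF.contDiff (n := 2)
    exact this.differentiable_deriv_two
  refine ⟨deriv F 0, F 0, fun s => ?_⟩
  have hdd : ∀ w, deriv (fun w => F w - deriv F 0 * w) w = 0 := by
    intro w
    have h1 : HasDerivAt (fun w => F w - deriv F 0 * w) (deriv F w - deriv F 0 * 1) w :=
      (hF w).hasDerivAt.sub ((hasDerivAt_id w).const_mul _)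
    rw [h1.deriv, is_const_of_deriv_eq_zero hd' h2 w 0]
    ring
  have := is_const_of_deriv_eq_zero
    (hF.sub ((differentiable_const _).mul differentiable_id)) hdd s 0
  simp at this
  linear_combination this

/-- A continuous logarithm of a holomorphic function is holomorphic. -/
theorem differentiableAt_of_differentiableAt_cexp {g : ℂ → ℂ} {s : ℂ} (hg : ContinuousAt g s)
    (hd : DifferentiableAt ℂ (fun z => exp (g z)) s) : DifferentiableAt ℂ g s := by
  have h1 : DifferentiableAt ℂ (fun z => g s + log (exp (g z) / exp (g s))) s := by
    refine ((hd.div_const _).clog ?_).const_add _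
    rw [div_self (exp_ne_zero _)]
    exact one_mem_slitPlane
  refine h1.congr_of_eventuallyEq ?_
  -- Near `s` this stays below `π`, so the principal logarithm recovers `g z - g s`.
  have h2 : ContinuousAt (fun z => |(g z - g s).im|) s :=
    (continuous_im.continuousAt.comp (hg.sub continuousAt_const)).abs
  have h3 : |(g s - g s).im| < Real.pi := by simpa using Real.pi_pos
  filter_upwards [h2.eventually (gt_mem_nhds h3)] with z hz
  rw [← exp_sub, log_exp (abs_lt.1 hz).1 (abs_lt.1 hz).2.le]
  ring

/-! ### Dirichlet series and holomorphy of the symbol. -/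

/-- The function `s ↦ n ^ (-s)` lies in the Wiener-Dirichlet algebra. -/
theorem cpow_neg_mem_wienerDirichlet {n : ℕ} (hn : n ≠ 0) :
    (fun s : RightHalfPlane => (n : ℂ) ^ (-(s : ℂ))) ∈ wienerDirichlet := by
  refine ⟨Pi.single n 1, summable_of_ne_finset_zero (s := {n}) fun k hk => ?_, fun s => ?_⟩
  · rw [Pi.single_eq_of_ne (by simpa using hk), norm_zero]
  · have := hasSum_single (f := LSeries.term (Pi.single n 1) (s : ℂ)) n fun k hk => by
      rcases eq_or_ne k 0 with rfl | h0
      · simp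
      · simp [LSeries.term_of_ne_zero h0, hk]
    rw [LSeries.term_of_ne_zero hn, Pi.single_eq_same, one_div, ← cpow_neg] at this
    exact this

/-- The Dirichlet series of `n ^ (-φ)`. -/
theorem InducesCompositionOperator.exists_LSeries_eq {φ : RightHalfPlane → RightHalfPlane}
    (hφ : InducesCompositionOperator φ) {n : ℕ} (hn : n ≠ 0) :
    ∃ a : ℕ → ℂ, a 0 = 0 ∧ LSeries.abscissaOfAbsConv a ≤ (0 : ℝ) ∧
      ∀ s : RightHalfPlane, LSeries a s = (n : ℂ) ^ (-(φ s : ℂ)) := by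
  obtain ⟨a, -, ha⟩ := hφ _ (cpow_neg_mem_wienerDirichlet hn)
  -- The series ignores index `0`; zeroing that coefficient makes the first nonzero index positive.
  have hcongr : ∀ {k : ℕ}, k ≠ 0 → (if k = 0 then 0 else a k) = a k := fun hk => if_neg hk
  refine ⟨fun k => if k = 0 then 0 else a k, if_pos rfl, ?_, fun s => ?_⟩
  · rw [LSeries.abscissaOfAbsConv_congr hcongr]
    exact LSeries.abscissaOfAbsConv_le_of_forall_lt_LSeriesSummable fun y hy =>
      (ha ⟨(y : ℂ), by simpa using hy⟩).LSeriesSummable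
  · rw [LSeries_congr hcongr]
    exact (ha s).LSeries_eq

/-- If `φ` is the restriction of a continuous function, it is holomorphic. -/
theorem InducesCompositionOperator.differentiableAt {φ : RightHalfPlane → RightHalfPlane}
    (hφ : InducesCompositionOperator φ) {Φ : ℂ → ℂ} (hΦ : ContinuousOn Φ {s : ℂ | 0 ≤ s.re})
    (hext : ∀ s : RightHalfPlane, Φ (s : ℂ) = (φ s : ℂ)) {s : ℂ} (hs : 0 < s.re) :
    DifferentiableAt ℂ Φ s := by
  obtain ⟨a, -, ha, hLa⟩ := hφ.exists_LSeries_eq two_ne_zero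
  have hopen : {s : ℂ | 0 < s.re} ∈ 𝓝 s := (isOpen_lt continuous_const continuous_re).mem_nhds hs
  have hcont : ContinuousAt Φ s :=
    hΦ.continuousAt (mem_of_superset hopen fun z (hz : 0 < z.re) => hz.le)
  have hlog : log 2 ≠ 0 := by
    rw [← ofReal_ofNat, ← ofReal_log zero_le_two, Ne, ofReal_eq_zero]
    exact (Real.log_pos one_lt_two).ne'
  have hL : DifferentiableAt ℂ (LSeries a) s :=
    (LSeries_hasDerivAt (ha.trans_lt (by exact_mod_cast hs))).differentiableAt
  have he : DifferentiableAt ℂ (fun z => exp (-log 2 * Φ z)) s := by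
    refine hL.congr_of_eventuallyEq ?_
    filter_upwards [hopen] with z hz
    rw [hLa ⟨z, hz⟩, ← hext, Nat.cast_ofNat, cpow_def_of_ne_zero two_ne_zero]
    congr 1
    ring
  have := (differentiableAt_of_differentiableAt_cexp (continuousAt_const.mul hcont) he).const_mul
    (-log 2)⁻¹
  simpa [hlog] using this

/-! ### Reflection and the affine form. -/

/-- A holomorphic self-map of the right half-plane that extends continuously to the closed
half-plane and maps the imaginary axis to itself is affine. -/
theorem eq_affine_of_mapsTo_re_pos {Φ : ℂ → ℂ} (hΦ : ContinuousOn Φ {s : ℂ | 0 ≤ s.re})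
    (hd : ∀ s : ℂ, 0 < s.re → DifferentiableAt ℂ Φ s) (hpos : ∀ s : ℂ, 0 < s.re → 0 < (Φ s).re)
    (h0 : ∀ s : ℂ, s.re = 0 → (Φ s).re = 0) :
    ∃ c τ : ℝ, ∀ s : ℂ, 0 ≤ s.re → Φ s = c * s + I * τ := by
  -- Projecting onto the closed half-plane makes `A` continuous on all of `ℂ`, ready for gluing.
  let A : ℂ → ℂ := fun s => Φ (⟨max s.re 0, s.im⟩ : ℂ)
  have hA : Continuous A := by
    refine hΦ.comp_continuous ?_ fun s => le_max_right s.re 0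
    have : (fun s : ℂ => (⟨max s.re 0, s.im⟩ : ℂ)) =
        fun s : ℂ => ((max s.re 0 : ℝ) : ℂ) + (s.im : ℂ) * I :=
      funext fun s => mk_eq_add_mul_I _ _
    rw [this]
    fun_prop
  have hAeq : ∀ s : ℂ, 0 ≤ s.re → A s = Φ s := fun s hs => by simp only [A, max_eq_left hs]
  let B : ℂ → ℂ := fun s => -(starRingEnd ℂ) (A (-(starRingEnd ℂ) s))
  have hB : Continuous B := (continuous_conj.comp (hA.comp continuous_conj.neg)).neg
  let F : ℂ → ℂ := fun s => if 0 ≤ s.re then A s else B s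
  have hFr : ∀ s : ℂ, 0 ≤ s.re → F s = Φ s := fun s hs => by simp only [F, if_pos hs, hAeq s hs]
  have hFl : ∀ s : ℂ, s.re < 0 → F s = -(starRingEnd ℂ) (Φ (-(starRingEnd ℂ) s)) := fun s hs => by
    simp only [F, if_neg hs.not_ge, B]
    rw [hAeq _ (by simpa using hs.le)]
  have hF : Continuous F := by
    refine Continuous.if_le hA hB continuous_const continuous_re fun s hs => ?_
    have hs' : -(starRingEnd ℂ) s = s := Complex.ext (by simp [← hs]) (by simp)
    have hre : (A s).re = 0 := by rw [hAeq s hs.le]; exact h0 s hs.symm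
    simp only [B, hs']
    exact Complex.ext (by simp [hre]) (by simp)
  have hFd : Differentiable ℂ F := by
    refine differentiable_of_continuous_of_re_ne_zero hF fun s hs => ?_
    rcases hs.lt_or_gt with hs | hs
    · have h1 : DifferentiableAt ℂ (fun z => Φ (-z)) ((starRingEnd ℂ) s) :=
        (hd (-(starRingEnd ℂ) s) (by simpa using hs)).comp _ differentiable_neg.differentiableAt
      have h2 := h1.hasDerivAt.conj_conj.differentiableAt
      rw [conj_conj] at h2
      refine h2.neg.congr_of_eventuallyEq ?_
      filter_upwards [(isOpen_lt continuous_re continuous_const).mem_nhds hs] with z hz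
      exact hFl z hz
    · refine (hd s hs).congr_of_eventuallyEq ?_
      filter_upwards [(isOpen_lt continuous_const continuous_re).mem_nhds hs] with z hz
      exact hFr z (le_of_lt hz)
  have hbound : ∀ s : ℂ, 0 < s.re → ‖Φ s‖ * s.re ≤ ‖Φ 1‖ * (‖s‖ + 1) ^ 2 := fun s hs => by
    refine (norm_mul_re_le_of_mapsTo_re_pos
      (fun z hz => (hd z hz).differentiableWithinAt) hpos hs).trans ?_
    gcongr
    simpa using norm_add_le s 1
  obtain ⟨a, b, hab⟩ := eq_affine_of_norm_mul_abs_re_le hFd (C := ‖Φ 1‖) fun s => by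
    rcases lt_trichotomy s.re 0 with hs | hs | hs
    · have := hbound (-(starRingEnd ℂ) s) (by simpa using hs)
      rw [hFl s hs, abs_of_neg hs]
      simpa using this
    · rw [hs, abs_zero, mul_zero]
      positivity
    · rw [hFr s hs.le, abs_of_pos hs]
      exact hbound s hs
  have hΦab : ∀ s : ℂ, 0 ≤ s.re → Φ s = a * s + b := fun s hs => by rw [← hFr s hs, hab]
  have hb : b.re = 0 := by
    have := h0 0 rfl
    rwa [hΦab 0 le_rfl, mul_zero, zero_add] at this
  have ha : a.im = 0 := by
    have := h0 I I_re
    rw [hΦab I I_re.ge] at this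
    simpa [hb] using this
  refine ⟨a.re, b.im, fun s hs => ?_⟩
  rw [hΦab s hs, mul_comm I]
  congr 1
  · rw [← re_add_im a, ha]; simp
  · conv_lhs => rw [← re_add_im b, hb]
    simp

/-- If `n ^ (-(c s + iτ))` is a Dirichlet series, then `n ^ c` is an integer. -/
theorem exists_nat_eq_rpow_of_LSeries_eq {a : ℕ → ℂ} (ha0 : a 0 = 0)
    (ha : LSeries.abscissaOfAbsConv a < ⊤) {n : ℕ} (hn : n ≠ 0) {c τ : ℝ}
    (h : ∀ x : ℝ, 0 < x → LSeries a x = (n : ℂ) ^ (-((c : ℂ) * x + I * τ))) :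
    ∃ m : ℕ, (n : ℝ) ^ c = m := by
  have hn0 : (0 : ℝ) < n := by positivity
  have hex : ∃ k, a k ≠ 0 := by
    by_contra! h0
    have h1 := h 1 one_pos
    rw [show a = 0 from funext h0, LSeries_zero, Pi.zero_apply] at h1
    exact (Nat.cast_ne_zero.2 hn : (n : ℂ) ≠ 0) (cpow_eq_zero_iff _ _ |>.1 h1.symm).1
  classical
  obtain ⟨m, hm⟩ := Nat.exists_eq_succ_of_ne_zero
    (fun h0 : Nat.find hex = 0 => Nat.find_spec hex (h0 ▸ ha0))
  have hlt : ∀ k ≤ m, a k = 0 := fun k hk => by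
    by_contra h0
    have := Nat.find_min' hex h0
    omega
  have hne : a (m + 1) ≠ 0 := by
    have := Nat.find_spec hex
    rwa [hm] at this
  have hlim := (LSeries.tendsto_cpow_mul_atTop hlt ha).norm
  set r : ℝ := (m + 1) / (n : ℝ) ^ c with hr
  have hr0 : 0 < r := by positivity
  -- Here `r ^ x = (m + 1) ^ x * ‖n ^ (-(c x + iτ))‖`; a nonzero limit, compared with its shift by
  -- `1`, forces `r = 1`.
  have hlim' : Tendsto (fun x : ℝ => r ^ x) atTop (𝓝 ‖a (m + 1)‖) := by
    refine hlim.congr' ?_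
    filter_upwards [eventually_gt_atTop 0] with x hx
    rw [h x hx, norm_mul, norm_natCast_cpow_of_pos (Nat.pos_of_ne_zero hn), ← Nat.cast_add_one,
      norm_natCast_cpow_of_pos m.succ_pos, hr, Real.div_rpow (by positivity) (by positivity),
      ← Real.rpow_mul hn0.le, div_eq_mul_inv, ← Real.rpow_neg hn0.le]
    simp
  have hshift : Tendsto (fun x : ℝ => r ^ (x + 1)) atTop (𝓝 ‖a (m + 1)‖) :=
    hlim'.comp (tendsto_atTop_add_const_right _ 1 tendsto_id)
  have heq : ‖a (m + 1)‖ * r = ‖a (m + 1)‖ := by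
    refine tendsto_nhds_unique ((hlim'.mul_const r).congr fun x => ?_) hshift
    rw [Real.rpow_add_one hr0.ne']
  have hr1 : r = 1 := mul_left_cancel₀ (norm_ne_zero_iff.2 hne) (heq.trans (mul_one _).symm)
  refine ⟨m + 1, ?_⟩
  rw [hr, div_eq_one_iff_eq (by positivity)] at hr1
  rw [← hr1]
  push_cast
  rfl

theorem theorem5p2 (φ : RightHalfPlane → RightHalfPlane)
    (hφ : InducesCompositionOperator φ)
    (hext : ∃ Φ : ℂ → ℂ, ContinuousOn Φ {s : ℂ | 0 ≤ s.re} ∧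
      (∀ s : RightHalfPlane, Φ (s : ℂ) = (φ s : ℂ)) ∧
      (∀ s : ℂ, s.re = 0 → (Φ s).re = 0)) :
    ∃ (c₀ : ℕ) (τ : ℝ), ∀ s : RightHalfPlane,
      (φ s : ℂ) = (c₀ : ℂ) * (s : ℂ) + Complex.I * (τ : ℂ) := by
  obtain ⟨Φ, hΦ, hΦφ, h0⟩ := hext
  obtain ⟨c, τ, hcτ⟩ := eq_affine_of_mapsTo_re_pos hΦ
    (fun s hs => hφ.differentiableAt hΦ hΦφ hs)
    (fun s hs => by rw [hΦφ ⟨s, hs⟩]; exact (φ ⟨s, hs⟩).2) h0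
  have hφeq : ∀ s : RightHalfPlane, (φ s : ℂ) = c * s + I * τ := fun s => by
    rw [← hΦφ s, hcτ _ s.2.le]
  obtain ⟨k, rfl⟩ := exists_nat_eq_of_forall_rpow_int fun n hn => by
    obtain ⟨a, ha0, ha, hLa⟩ := hφ.exists_LSeries_eq (Nat.one_le_iff_ne_zero.1 hn)
    obtain ⟨m, hm⟩ := exists_nat_eq_rpow_of_LSeries_eq ha0 (ha.trans_lt (EReal.coe_lt_top 0))
      (Nat.one_le_iff_ne_zero.1 hn) (c := c) (τ := τ) fun x hx => by
        rw [hLa ⟨(x : ℂ), by simpa using hx⟩, hφeq]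
    exact ⟨m, by exact_mod_cast hm⟩
  exact ⟨k, τ, by exact_mod_cast hφeq⟩
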